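/- Let $A$ be a finite alphabet and let $\sigma : A \rightarrow A^*$ be a substitution, iterated by concatenation. Assume that $\sigma$ is primitive (there is $k\ge 1$ such that every letter of $A$ occurs in $\sigma^k(c)$ for every $c\in A$) and proper (there is $a\in A$ such that for all $c\in A$ the word $\sigma(c)$ begins with the letter $a$). Let $(X,T)$ be the subshift generated by $\sigma$: $X\subset A^{\mathbb Z}$ is the set of two-sided sequences all of whose finite factors occur in some $\sigma^n(c)$, $n\in\mathbb N$, $c\in A$, and $T$ is the shift. Assume that $(X,T)$ is non-periodic, i.e. that no power $T^k$ with $k\ge 1$ is the identity of $X$. Let ${\cal P}(X,T)$ be the periodic spectrum of $(X,T)$, i.e. the set of positive integers $q$ for which there are pairwise disjoint clopen sets $Y, TY, \dots, T^{q-1}Y$ whose union is $X$. Let $p$ be a non-negative integer. The following are equivalent. (i) For all $n\in\mathbb N$ there exists $m\in\mathbb N$ such that $p^n$ divides $\gcd\{|\sigma^m(c)| : c\in A\}$. (ii) $p^n\in{\cal P}(X,T)$ for all $n\in\mathbb N$. -/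

import Mathlib

open SymbolicDynamics.FullShift

section Words

variable {A : Type*}

/-- The morphism of `A^*` that extends `σ : A → A^*` by concatenation, `A^*` being `List A`. -/
def substWord (σ : A → List A) (w : List A) : List A := w.flatMap σ

/-- The word `σ^n(c)`, for a letter `c`. -/
def substPow (σ : A → List A) (n : ℕ) (c : A) : List A := (substWord σ)^[n] [c]

/-- `σ` is proper: all the words `σ(c)` begin with one and the same letter `a`. -/
def IsProperSubst (σ : A → List A) : Prop :=
  ∃ a : A, ∀ c : A, ∃ w : List A, σ c = a :: w

/-- `σ` is primitive: for some `k ≥ 1`, every letter occurs in the `k`-th iterate of every letter. -/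
def IsPrimitiveSubst (σ : A → List A) : Prop :=
  ∃ k : ℕ, 0 < k ∧ ∀ b c : A, b ∈ substPow σ k c

/-- The language of `σ`: the words that occur in some `σ^n(c)`. -/
def substLanguage (σ : A → List A) : Set (List A) :=
  {w | ∃ (n : ℕ) (c : A), w <:+: substPow σ n c}

/-- The factor `x_i x_{i+1} ⋯ x_{i+l-1}` of a two-sided sequence `x`. -/
def factorWord (x : ℤ → A) (i : ℤ) (l : ℕ) : List A :=
  List.ofFn fun j : Fin l => x (i + (j : ℤ))

end Words

section Dynamics

/-- The subshift generated by `σ`: the two-sided sequences all of whose finite factors belong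
to the language of `σ`. -/
def substSubshift {A : Type*} [TopologicalSpace A] [DiscreteTopology A] (σ : A → List A) :
    Subshift A ℤ where
  carrier := {x | ∀ (i : ℤ) (l : ℕ), factorWord x i l ∈ substLanguage σ}
  isClosed := by
    simp only [Set.ofPred_forall]
    refine isClosed_iInter fun i => isClosed_iInter fun l => ?_
    have hc : Continuous fun (x : ℤ → A) (j : Fin l) => x (i + (j : ℤ)) := by fun_prop
    exact (isClosed_discrete {w : Fin l → A | List.ofFn w ∈ substLanguage σ}).preimage hc
  mapsTo := by
    intro g x hx i l
    have h := hx (g + i) l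
    simpa only [factorWord, shift_apply, add_assoc] using h

/-- The shift `T` of a subshift `X`, `(T x)_i = x_{i+1}`, as a homeomorphism of `X`. -/
def subshiftHomeo {A : Type*} [TopologicalSpace A] (X : Subshift A ℤ) :
    X.carrier ≃ₜ X.carrier where
  toFun := (X.mapsTo 1).restrict
  invFun := (X.mapsTo (-1)).restrict
  left_inv := fun x => Subtype.ext <| funext fun i => congrArg x.1 (by ring)
  right_inv := fun x => Subtype.ext <| funext fun i => congrArg x.1 (by ring)
  continuous_toFun := (continuous_shift (1 : ℤ)).restrict (X.mapsTo 1)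
  continuous_invFun := (continuous_shift (-1 : ℤ)).restrict (X.mapsTo (-1))

variable {Z : Type*} [TopologicalSpace Z]

/-- The system `(Z, S)` is periodic: some positive power of `S` is the identity. For a subshift
this says that `Z` is finite, and for a minimal one that `Z` contains a periodic point. -/
def IsPeriodicSystem (S : Z ≃ₜ Z) : Prop :=
  ∃ n : ℕ, 0 < n ∧ ∀ z : Z, S^[n] z = z

/-- The periodic spectrum of `(Z, S)`: the positive integers `p` for which there are pairwise
disjoint clopen sets `Y, S Y, …, S^{p-1} Y` with union `Z`. -/
def periodicSpectrum (S : Z ≃ₜ Z) : Set ℕ :=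
  {p | 0 < p ∧ ∃ Y : Set Z,
    (∀ i < p, IsClopen (S^[i] '' Y)) ∧
    (∀ i < p, ∀ j < p, i ≠ j → Disjoint (S^[i] '' Y) (S^[j] '' Y)) ∧
    (⋃ i < p, S^[i] '' Y) = Set.univ}

end Dynamics

/-!
Fix `q`, and say that a sequence has phase `s` modulo `q` if its factors at each position `i` are
read at positions congruent to `s + i` in arbitrarily late words `σ^t(c)` (`phaseSet`). The sets of
sequences of phase `s` are closed, they cover the subshift, and the shift takes phase `s` to phase
`s + 1`. If `q` divides all the lengths `|σ^m(c)|`, then `T^q` is minimal on each of them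
(`phaseSet_subset_of_mem`), so that they are equal or disjoint.

From lengths to the spectrum, no recognizability theorem is needed: it is enough that a sequence has
at most `B` phases, with `B` independent of `q` (`exists_card_le_of_mem_phaseSet`). Each phase
of `x` gives an occurrence of some `σ^m(c)` in a window of `x` of length `max |σ^m(c)|`, and different
phases give different positions. If there are many phases, two occurrences of the same `σ^m(c)` are
at a distance `ℓ > 0` that is small compared with all `|σ^m(b)|`, so `ℓ` is a period of `σ^m(c)`.
But all factors of length `ℓ + 1` occur in `σ^m(c)`; their first and last letters agree, and
`T^ℓ` is the identity, which is excluded. With this bound, take `q = p^(n + B)`: the phases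
of a sequence form a coset of a subgroup of `ZMod q` of order at most `B`, on which `p^B` vanishes,
so the phase is well defined modulo `p^n` and is a continuous eigenfunction.

From the spectrum to lengths, let `Y` be the clopen set of the partition. Membership in `Y`
depends on a window of bounded length (`exists_window_of_isClopen`), and all `σ^t(c)` begin with the same long
word. If `σ^t(c) σ^t(d)` occurs in `x`, the windows at the beginnings of the two blocks agree, so
`|σ^t(c)|` is the time between two visits to `Y`, and hence a multiple of `q`.
-/

/-! ### Words -/

section Words

variable {A : Type*} {σ : A → List A}

/-- The factor of length `l` of `x` at position `i` is read in the word `v` at position `j`. -/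
def ReadsAt (v : List A) (j : ℕ) (x : ℤ → A) (i : ℤ) (l : ℕ) : Prop :=
  ∀ r < l, v[j + r]? = some (x (i + r))

theorem ReadsAt.le_length {v : List A} {j : ℕ} {x : ℤ → A} {i : ℤ} {l : ℕ}
    (h : ReadsAt v j x i l) (hl : 0 < l) : j + l ≤ v.length := by
  have h1 := h (l - 1) (by omega)
  have := (List.getElem?_eq_some_iff.1 h1).1
  omega

theorem ReadsAt.sub {v : List A} {j : ℕ} {x : ℤ → A} {i : ℤ} {l : ℕ} (h : ReadsAt v j x i l)
    (a : ℕ) {l' : ℕ} (hl : a + l' ≤ l) : ReadsAt v (j + a) x (i + a) l' := by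
  intro r hr
  have := h (a + r) (by omega)
  rw [← add_assoc] at this
  rw [this]
  push_cast
  ring_nf

theorem readsAt_of_factorWord {v v₁ v₂ : List A} {x : ℤ → A} {i : ℤ} {l : ℕ}
    (h : v₁ ++ factorWord x i l ++ v₂ = v) : ReadsAt v v₁.length x i l := by
  intro r hr
  have hl : (factorWord x i l).length = l := by simp [factorWord]
  rw [← h, List.append_assoc, List.getElem?_append_right (by omega), Nat.add_sub_cancel_left,
    List.getElem?_append_left (by omega)]
  simp [factorWord, hr]

theorem exists_readsAt_of_factorWord {v : List A} {x : ℤ → A} {i : ℤ} {l : ℕ}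
    (h : factorWord x i l <:+: v) : ∃ j, ReadsAt v j x i l := by
  obtain ⟨v₁, v₂, h⟩ := h
  exact ⟨_, readsAt_of_factorWord h⟩

/-- Reading inside a larger word. -/
theorem ReadsAt.append {v : List A} {j : ℕ} {x : ℤ → A} {i : ℤ} {l : ℕ} (h : ReadsAt v j x i l)
    (v₁ v₂ : List A) : ReadsAt (v₁ ++ v ++ v₂) (v₁.length + j) x i l := by
  intro r hr
  have h1 := h r hr
  have h2 := (List.getElem?_eq_some_iff.1 h1).1
  rw [List.append_assoc, List.getElem?_append_right (by omega),
    List.getElem?_append_left (by omega), ← h1]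
  congr 1
  omega

/-- If a concatenation is read at its beginning, its middle part is read. -/
theorem ReadsAt.middle {v₁ v v₂ : List A} {x : ℤ → A} {i : ℤ}
    (h : ReadsAt (v₁ ++ v ++ v₂) 0 x i (v₁ ++ v ++ v₂).length) :
    ReadsAt v 0 x (i + v₁.length) v.length := by
  intro r hr
  have h1 := h (v₁.length + r) (by simp only [List.length_append]; omega)
  rw [List.append_assoc, List.getElem?_append_right (by omega),
    List.getElem?_append_left (by omega)] at h1
  rw [zero_add] at h1 ⊢
  rw [Nat.add_sub_cancel_left] at h1
  rw [h1]
  push_cast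
  ring_nf

theorem substWord_append (τ : A → List A) (v w : List A) :
    substWord τ (v ++ w) = substWord τ v ++ substWord τ w := by
  simp [substWord]

theorem substWord_iterate (n : ℕ) (w : List A) :
    (substWord σ)^[n] w = substWord (substPow σ n) w := by
  induction w with
  | nil => exact Function.iterate_fixed (by simp [substWord]) n
  | cons c w ih =>
    have key : ∀ (n : ℕ) (v w : List A),
        (substWord σ)^[n] (v ++ w) = (substWord σ)^[n] v ++ (substWord σ)^[n] w := by
      intro n
      induction n with
      | zero => intros; rfl
      | succ n ihn => intro v w; simp only [Function.iterate_succ_apply, substWord_append, ihn]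
    have := key n [c] w
    rw [List.singleton_append] at this
    rw [this, ih]
    simp [substWord, substPow]

theorem substPow_add (m n : ℕ) (c : A) :
    substPow σ (m + n) c = substWord (substPow σ m) (substPow σ n c) := by
  rw [← substWord_iterate, substPow, Function.iterate_add_apply, substPow]

theorem substWord_isInfix (τ : A → List A) {v w : List A} (h : v <:+: w) :
    substWord τ v <:+: substWord τ w := by
  obtain ⟨a, b, rfl⟩ := h
  exact ⟨substWord τ a, substWord τ b, by simp only [substWord_append]⟩

theorem isInfix_substWord (τ : A → List A) {c : A} {w : List A} (h : c ∈ w) :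
    τ c <:+: substWord τ w := by
  obtain ⟨a, b, rfl⟩ := List.append_of_mem h
  exact ⟨substWord τ a, substWord τ b, by simp [substWord]⟩

theorem dvd_length_substWord {τ : A → List A} {q : ℕ} (h : ∀ c, q ∣ (τ c).length) (w : List A) :
    q ∣ (substWord τ w).length := by
  induction w with
  | nil => simp [substWord]
  | cons c w ih =>
    have : substWord τ (c :: w) = τ c ++ substWord τ w := by simp [substWord]
    rw [this, List.length_append]
    exact dvd_add (h c) ih

theorem length_substWord_le {τ : A → List A} {h : ℕ} (hh : ∀ c, (τ c).length ≤ h) (w : List A) :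
    (substWord τ w).length ≤ w.length * h := by
  induction w with
  | nil => simp [substWord]
  | cons c w ih =>
    have : substWord τ (c :: w) = τ c ++ substWord τ w := by simp [substWord]
    rw [this, List.length_append, List.length_cons, add_one_mul]
    have := hh c
    omega

theorem dvd_length_substPow_of_le {q m t : ℕ} (h : ∀ c, q ∣ (substPow σ m c).length) (ht : m ≤ t)
    (c : A) : q ∣ (substPow σ t c).length := by
  obtain ⟨n, rfl⟩ := Nat.exists_eq_add_of_le ht
  rw [substPow_add]
  exact dvd_length_substWord h _

/-- A block `τ c` of `τ w` begins less than `M` after a given position, if the blocks have length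
at most `M` and `τ w` extends far enough. -/
theorem exists_block {τ : A → List A} {M : ℕ} (hM : 0 < M) (hτ : ∀ c, (τ c).length ≤ M)
    (w : List A) (J : ℕ) (hJ : J + M ≤ (substWord τ w).length) :
    ∃ w₁ c w₂, w = w₁ ++ [c] ++ w₂ ∧ J ≤ (substWord τ w₁).length ∧
      (substWord τ w₁).length < J + M := by
  induction w generalizing J with
  | nil => simp [substWord] at hJ; omega
  | cons c w ih =>
    have hc : ∀ w, (substWord τ (c :: w)).length = (τ c).length + (substWord τ w).length := by
      intro w; simp [substWord]
    have h1 := hτ c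
    rw [hc] at hJ
    rcases Nat.eq_zero_or_pos J with rfl | hJ0
    · exact ⟨[], c, w, by simp, by simp, by simpa [substWord] using hM⟩
    rcases le_or_gt J (τ c).length with hle | hlt
    · cases w with
      | nil => simp [substWord] at hJ; omega
      | cons d w =>
        refine ⟨[c], d, w, by simp, ?_, ?_⟩ <;> rw [hc] <;> simp [substWord] <;> omega
    · obtain ⟨w₁, e, w₂, rfl, h2, h3⟩ := ih (J - (τ c).length) (by omega)
      refine ⟨c :: w₁, e, w₂, by simp, ?_, ?_⟩ <;> rw [hc] <;> omega

/-- A factor of `τ w` that is no longer than any block lies in at most two consecutive blocks. -/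
theorem exists_two_blocks {τ : A → List A} {l : ℕ} (hτ : ∀ c, l ≤ (τ c).length)
    (w : List A) (J : ℕ) (hJ : J + l ≤ (substWord τ w).length) :
    ∃ w₁ v w₂, w = w₁ ++ v ++ w₂ ∧ v.length ≤ 2 ∧ (substWord τ w₁).length ≤ J ∧
      J + l ≤ (substWord τ w₁).length + (substWord τ v).length := by
  induction w generalizing J with
  | nil => exact ⟨[], [], [], by simpa [substWord] using hJ⟩
  | cons c w ih =>
    have hc : ∀ w, (substWord τ (c :: w)).length = (τ c).length + (substWord τ w).length := by
      intro w; simp [substWord]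
    rcases lt_or_ge J (τ c).length with hlt | hge
    · cases w with
      | nil =>
        exact ⟨[], [c], [], by simp, by simp, by simp [substWord], by simpa [substWord] using hJ⟩
      | cons d w =>
        refine ⟨[], [c, d], w, by simp, by simp, by simp [substWord], ?_⟩
        have := hτ d
        simp [substWord]
        omega
    · rw [hc] at hJ
      obtain ⟨w₁, v, w₂, rfl, h2, h3, h4⟩ := ih (J - (τ c).length) (by omega)
      refine ⟨c :: w₁, v, w₂, by simp, h2, ?_, ?_⟩ <;> rw [hc] <;> omega

end Words

/-! ### Primitive substitutions -/

section Primitive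

variable {A : Type*} {σ : A → List A}

theorem exists_mem_substPow (hprim : IsPrimitiveSubst σ) :
    ∃ k, ∀ t ≥ k, ∀ b c : A, b ∈ substPow σ t c := by
  obtain ⟨k, hk0, hk⟩ := hprim
  have hne : ∀ t (c : A), substPow σ t c ≠ [] := by
    -- an empty iterate would stay empty, while some multiple of `k` exceeds `t`
    intro t c h
    have h1 : ∀ s (c : A), c ∈ substPow σ (s * k) c := by
      intro s
      induction s with
      | zero => intro c; simp [substPow]
      | succ s ih =>
        intro c
        rw [add_one_mul, substPow_add]
        exact (isInfix_substWord _ (hk c c)).subset (ih c)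
    have h2 := h1 t c
    obtain ⟨r, hr⟩ := Nat.exists_eq_add_of_le (Nat.le_mul_of_pos_right t hk0)
    have h3 : (substWord σ)^[r + t] [c] = [] := by
      rw [Function.iterate_add_apply, show (substWord σ)^[t] [c] = [] from h]
      exact Function.iterate_fixed (by simp [substWord]) r
    rw [hr, add_comm, substPow, h3] at h2
    simp at h2
  refine ⟨k, fun t ht b c => ?_⟩
  obtain ⟨s, rfl⟩ := Nat.exists_eq_add_of_le ht
  rw [substPow_add]
  obtain ⟨e, he⟩ := List.exists_mem_of_ne_nil _ (hne s c)
  exact (isInfix_substWord _ he).subset (hk b e)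

/-- Every word of the language occurs in all late iterates of all letters. -/
theorem eventually_isInfix_substPow (hprim : IsPrimitiveSubst σ) {u : List A}
    (hu : u ∈ substLanguage σ) : ∀ᶠ t in Filter.atTop, ∀ c : A, u <:+: substPow σ t c := by
  obtain ⟨k, hk⟩ := exists_mem_substPow hprim
  obtain ⟨n, b, hb⟩ := hu
  refine Filter.eventually_atTop.2 ⟨n + k, fun t ht c => ?_⟩
  obtain ⟨s, rfl⟩ := Nat.exists_eq_add_of_le (show n ≤ t by omega)
  rw [substPow_add]
  exact hb.trans (isInfix_substWord _ (hk s (by omega) b c))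

/-- The lengths of the iterates tend to infinity as soon as the subshift is not empty. -/
theorem eventually_le_length_substPow [TopologicalSpace A] [DiscreteTopology A]
    (hprim : IsPrimitiveSubst σ) {x : ℤ → A} (hx : x ∈ (substSubshift σ).carrier) (l : ℕ) :
    ∀ᶠ t in Filter.atTop, ∀ c : A, l ≤ (substPow σ t c).length := by
  filter_upwards [eventually_isInfix_substPow hprim (hx 0 l)] with t ht c
  simpa [factorWord] using (ht c).length_le

end Primitive

/-! ### Phases modulo `q` -/

section Phase

variable {A : Type*} {σ : A → List A}

/-- The sequences of phase `s` modulo `q`: every factor at position `i` is read at a position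
congruent to `s + i` in some `σ^t(c)` with `t` arbitrarily large. If `q` divides the lengths of the
words `σ^m(c)`, then these are the sequences that are cut into such words at positions
congruent to `-s`. -/
def phaseSet (σ : A → List A) (q : ℕ) (s : ZMod q) : Set (ℤ → A) :=
  {x | ∀ (i : ℤ) (l t₀ : ℕ), ∃ t ≥ t₀, ∃ c j, ReadsAt (substPow σ t c) j x i l ∧
    (j : ZMod q) = s + i}

theorem isClosed_phaseSet [TopologicalSpace A] [DiscreteTopology A] (q : ℕ) (s : ZMod q) :
    IsClosed (phaseSet σ q s) := by
  simp only [phaseSet, Set.ofPred_forall]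
  refine isClosed_iInter fun i => isClosed_iInter fun l => isClosed_iInter fun t₀ => ?_
  have hc : Continuous fun (x : ℤ → A) (r : Fin l) => x (i + (r : ℕ)) := by fun_prop
  convert (isClosed_discrete {w : Fin l → A | ∃ t ≥ t₀, ∃ c, ∃ j : ℕ,
    (∀ r : Fin l, (substPow σ t c)[j + (r : ℕ)]? = some (w r)) ∧ (j : ZMod q) = s + i}).preimage hc
    using 1
  ext x
  simp only [Set.mem_ofPred_eq, Set.mem_preimage, ReadsAt, Fin.forall_iff]

theorem mem_phaseSet_shift {q : ℕ} {s : ZMod q} {x : ℤ → A} (h : x ∈ phaseSet σ q s) (k : ℤ) :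
    (fun i => x (i + k)) ∈ phaseSet σ q (s + k) := by
  intro i l t₀
  obtain ⟨t, ht, c, j, h1, h2⟩ := h (i + k) l t₀
  refine ⟨t, ht, c, j, fun r hr => ?_, ?_⟩
  · rw [h1 r hr, add_right_comm]
  · rw [h2]
    push_cast
    ring

/-- Every sequence of the subshift has a phase. -/
theorem exists_mem_phaseSet [TopologicalSpace A] [DiscreteTopology A] (hprim : IsPrimitiveSubst σ)
    {q : ℕ} (hq : 0 < q) {x : ℤ → A} (hx : x ∈ (substSubshift σ).carrier) :
    ∃ s, x ∈ phaseSet σ q s := by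
  have : NeZero q := ⟨hq.ne'⟩
  by_contra! hcon
  simp only [phaseSet, Set.mem_ofPred_eq, not_forall] at hcon
  choose i l t₀ hf using hcon
  -- a window and a level that exceed all those at which the finitely many phases fail
  obtain ⟨N, hN⟩ := (Set.finite_range fun s => (i s).natAbs + l s + t₀ s).bddAbove
  replace hN : ∀ s, (i s).natAbs + l s + t₀ s ≤ N := fun s => hN ⟨s, rfl⟩
  obtain ⟨c₀⟩ : Nonempty A := ⟨x 0⟩
  obtain ⟨t, h, ht⟩ := ((eventually_isInfix_substPow hprim (hx (-N) (2 * N))).and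
    (Filter.eventually_ge_atTop N)).exists
  obtain ⟨j, hj⟩ := exists_readsAt_of_factorWord (h c₀)
  have hs := hN ((j : ZMod q) + N)
  refine hf ((j : ZMod q) + N) ⟨t, by omega, c₀, j + (i ((j : ZMod q) + N) + N).toNat, ?_, ?_⟩
  · have := hj.sub (i ((j : ZMod q) + N) + N).toNat (l' := l ((j : ZMod q) + N)) (by omega)
    convert this using 1
    omega
  · rw [Nat.cast_add, ← Int.cast_natCast (i ((j : ZMod q) + N) + N).toNat,
      Int.toNat_of_nonneg (by omega)]
    push_cast
    ring

/-- A sequence of phase `s` contains complete words `σ^t(c)`, at positions congruent to `-s` and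
with gaps at most the maximal length of these words. -/
theorem exists_block_of_mem_phaseSet {q : ℕ} {s : ZMod q} {x : ℤ → A} (hx : x ∈ phaseSet σ q s)
    {t M : ℕ} (hq : ∀ c, q ∣ (substPow σ t c).length) (hM : 0 < M)
    (ht : ∀ c, (substPow σ t c).length ≤ M) (i : ℤ) :
    ∃ c, ∃ j < M, ReadsAt (substPow σ t c) 0 x (i + j) (substPow σ t c).length ∧
      s + i + j = 0 := by
  obtain ⟨t', ht', b, J, h1, h2⟩ := hx i (2 * M) t
  obtain ⟨n, rfl⟩ := Nat.exists_eq_add_of_le ht'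
  rw [substPow_add] at h1
  have hlen := h1.le_length (by omega)
  obtain ⟨w₁, c, w₂, hw, h3, h4⟩ := exists_block hM ht (substPow σ n b) J (by omega)
  refine ⟨c, (substWord (substPow σ t) w₁).length - J, by omega, ?_, ?_⟩
  · have hc := ht c
    have h5 := h1.sub ((substWord (substPow σ t) w₁).length - J)
      (l' := (substPow σ t c).length) (by omega)
    intro r hr
    have hsingle : substWord (substPow σ t) [c] = substPow σ t c := by simp [substWord]
    rw [← h5 r hr, hw, substWord_append, substWord_append, hsingle, List.append_assoc,
      List.getElem?_append_right (by omega), List.getElem?_append_left (by omega)]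
    congr 1
    omega
  · rw [Nat.cast_sub h3, ← h2, add_sub_cancel,
      (ZMod.natCast_eq_zero_iff _ _).2 (dvd_length_substWord hq w₁)]

/-- A word `σ^t(c)` that is as late as one likes is a factor of every sequence of phase `s`,
at a position congruent to `-s`. -/
theorem exists_readsAt_of_mem_phaseSet [Finite A] (hprim : IsPrimitiveSubst σ) {q : ℕ}
    {s : ZMod q} {x : ℤ → A} (hx : x ∈ phaseSet σ q s) {t : ℕ}
    (hq : ∀ c, q ∣ (substPow σ t c).length) (i₀ : ℤ) (c : A) :
    ∃ i ≥ i₀, ReadsAt (substPow σ t c) 0 x i (substPow σ t c).length ∧ s + i = 0 := by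
  obtain ⟨k, hk⟩ := exists_mem_substPow hprim
  obtain ⟨M, hM⟩ := (Set.finite_range fun c => (substPow σ (t + k) c).length).bddAbove
  replace hM : ∀ c, (substPow σ (t + k) c).length ≤ M + 1 := fun c => (hM ⟨c, rfl⟩).trans (by simp)
  obtain ⟨e, j, -, h1, h2⟩ := exists_block_of_mem_phaseSet hx
    (dvd_length_substPow_of_le hq (Nat.le_add_right t k)) (Nat.succ_pos M) hM i₀
  obtain ⟨w₁, w₂, hw⟩ := List.append_of_mem (hk k le_rfl c e)
  have hsub : substPow σ (t + k) e = substWord (substPow σ t) w₁ ++ substPow σ t c ++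
      substWord (substPow σ t) w₂ := by
    rw [substPow_add, hw, List.append_assoc, substWord_append]
    simp [substWord]
  rw [hsub] at h1
  refine ⟨_, by omega, h1.middle, ?_⟩
  rw [Int.cast_add, Int.cast_natCast,
    (ZMod.natCast_eq_zero_iff _ _).2 (dvd_length_substWord hq w₁)]
  push_cast
  rw [add_zero, ← h2]
  ring

/-- The `q`-th power of the shift is minimal on the sequences of phase `s`; therefore sets of
different phases are equal or disjoint. -/
theorem phaseSet_subset_of_mem [Finite A] (hprim : IsPrimitiveSubst σ) {q m : ℕ}
    (hq : ∀ c, q ∣ (substPow σ m c).length) {s s' : ZMod q} {x : ℤ → A}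
    (hx : x ∈ phaseSet σ q s) (hx' : x ∈ phaseSet σ q s') :
    phaseSet σ q s ⊆ phaseSet σ q s' := by
  intro y hy i l t₀
  obtain ⟨t, ht, c, J, h1, h2⟩ := hy i l m
  obtain ⟨i', -, h3, h4⟩ := exists_readsAt_of_mem_phaseSet hprim hx
    (dvd_length_substPow_of_le hq ht) 0 c
  -- the factor of `y` is also a factor of `x`, at a congruent position
  obtain ⟨t', ht', b, j, h5, h6⟩ := hx' (i' + J) l t₀
  refine ⟨t', ht', b, j, fun r hr => ?_, ?_⟩
  · have h7 := h3 (J + r) (List.getElem?_eq_some_iff.1 (h1 r hr)).1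
    rw [zero_add, Nat.cast_add, ← add_assoc] at h7
    rw [h5 r hr, ← h7, h1 r hr]
  · rw [h6]
    push_cast
    rw [h2]
    linear_combination h4

end Phase

/-! ### Non-periodicity bounds the number of phases -/

section Bound

theorem iterate_subshiftHomeo_apply {A : Type*} [TopologicalSpace A] (X : Subshift A ℤ)
    (n : ℕ) (z : X.carrier) (i : ℤ) :
    ((subshiftHomeo X)^[n] z).1 i = z.1 (i + n) := by
  induction n generalizing i with
  | zero => simp
  | succ n ih =>
    rw [Function.iterate_succ_apply']
    change ((subshiftHomeo X)^[n] z).1 (1 + i) = _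
    rw [ih]
    push_cast
    ring_nf

variable {A : Type*} {σ : A → List A} [TopologicalSpace A] [DiscreteTopology A]

/-- A period `ℓ` of `σ^m(c)` is a period of the subshift if the words of length `ℓ + 1` all occur in
`σ^m(c)`. -/
theorem isPeriodicSystem_of_period {v : List A} {ℓ : ℕ} (hℓ : 0 < ℓ)
    (hv : ∀ x ∈ (substSubshift σ).carrier, ∀ i, ∃ j, ReadsAt v j x i (ℓ + 1))
    (hper : ∀ r, r + ℓ < v.length → v[r + ℓ]? = v[r]?) :
    IsPeriodicSystem (subshiftHomeo (substSubshift σ)) := by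
  refine ⟨ℓ, hℓ, fun z => Subtype.ext (funext fun i => ?_)⟩
  rw [iterate_subshiftHomeo_apply]
  obtain ⟨j, hj⟩ := hv z.1 z.2 i
  have h1 := hj ℓ (by omega)
  rw [hper j (List.getElem?_eq_some_iff.1 h1).1] at h1
  have h0 := hj 0 (by omega)
  simp only [add_zero, Nat.cast_zero] at h0
  rw [h1] at h0
  exact Option.some.inj h0

/-- There is a `k₀` such that all factors no longer than the shortest word `σ^n(b)` occur in all
the words `σ^(n + k₀)(c)`. -/
theorem exists_forall_readsAt [Finite A] (hprim : IsPrimitiveSubst σ) :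
    ∃ k₀, ∀ n l, (∀ b, l ≤ (substPow σ n b).length) → ∀ c,
      ∀ x ∈ (substSubshift σ).carrier, ∀ i, ∃ j, ReadsAt (substPow σ (n + k₀) c) j x i l := by
  have hfin : {v : List A | v.length ≤ 2 ∧ v ∈ substLanguage σ}.Finite :=
    (List.finite_length_le A 2).subset fun v hv => hv.1
  obtain ⟨k₀, hk₀⟩ := ((Filter.eventually_all_finite hfin).2 fun v hv =>
    eventually_isInfix_substPow hprim hv.2).exists
  refine ⟨k₀, fun n l hl c x hx i => ?_⟩
  rcases Nat.eq_zero_or_pos l with rfl | hl0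
  · exact ⟨0, fun r hr => absurd hr (Nat.not_lt_zero r)⟩
  obtain ⟨t, h, ht⟩ := ((eventually_isInfix_substPow hprim (hx i l)).and
    (Filter.eventually_ge_atTop n)).exists
  obtain ⟨J, hJ⟩ := exists_readsAt_of_factorWord (h c)
  obtain ⟨t, rfl⟩ := Nat.exists_eq_add_of_le ht
  rw [substPow_add] at hJ
  obtain ⟨w₁, v, w₂, hw, hv2, h1, h2⟩ := exists_two_blocks hl _ J (hJ.le_length hl0)
  obtain ⟨a, b, hab⟩ := substWord_isInfix (substPow σ n)
    (hk₀ v ⟨hv2, t, c, ⟨w₁, w₂, hw.symm⟩⟩ c)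
  rw [← substPow_add] at hab
  have hread : ReadsAt (substWord (substPow σ n) v)
      (J - (substWord (substPow σ n) w₁).length) x i l := by
    intro r hr
    rw [← hJ r hr, hw, substWord_append, substWord_append, List.append_assoc,
      List.getElem?_append_right (by omega), List.getElem?_append_left (by omega)]
    congr 1
    omega
  exact ⟨_, hab ▸ hread.append a b⟩

/-- The number of phases modulo `q` of a sequence is bounded independently of `q`. If there are many
phases, two of the positions at which the words `σ^m(c)` begin are so close that some `σ^m(c)`
overlaps itself with a small shift `ℓ`; since all factors of length `ℓ + 1` occur in `σ^m(c)`, the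
system is then periodic. -/
theorem exists_card_le_of_mem_phaseSet [Finite A] (hprim : IsPrimitiveSubst σ)
    (hper : ¬ IsPeriodicSystem (subshiftHomeo (substSubshift σ))) :
    ∃ B : ℕ, ∀ q m : ℕ, (∀ c, q ∣ (substPow σ m c).length) → ∀ (x : ℤ → A) (F : Finset (ZMod q)),
      (∀ s ∈ F, x ∈ phaseSet σ q s) → F.card ≤ B := by
  classical
  have := Fintype.ofFinite A
  obtain ⟨k, hk⟩ := exists_mem_substPow hprim
  obtain ⟨k₀, hk₀⟩ := exists_forall_readsAt hprim
  obtain ⟨D, hD⟩ := (Set.finite_range fun c => (substPow σ (k + k₀) c).length).bddAbove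
  replace hD : ∀ c, (substPow σ (k + k₀) c).length ≤ D := fun c => hD ⟨c, rfl⟩
  refine ⟨Fintype.card A * D, fun q m₀ hq₀ x F hF => ?_⟩
  by_contra! hcard
  apply hper
  have : Nonempty A := ⟨x 0⟩
  set m := m₀ + k with hm
  have hq := dvd_length_substPow_of_le hq₀ (show m₀ ≤ m + k₀ by omega)
  obtain ⟨b, hb⟩ := Finite.exists_min fun b => (substPow σ m b).length
  set h := (substPow σ m b).length with hh
  have hle : ∀ c, (substPow σ (m + k₀) c).length ≤ D * h := by
    intro c
    rw [hm, add_assoc, substPow_add]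
    refine (length_substWord_le (h := h) (fun e => ?_) _).trans (Nat.mul_le_mul_right _ (hD c))
    rw [hh, hm, substPow_add]
    exact (isInfix_substWord _ (hk k le_rfl e b)).length_le
  have hh0 : 0 < h := by
    refine List.length_pos_of_mem (hk m (by omega) b b)
  have hD0 : 0 < D := by
    exact (List.length_pos_of_mem (hk (k + k₀) (by omega) b b)).trans_le (hD b)
  have hM : 0 < D * h := Nat.mul_pos hD0 hh0
  choose! c j hj hread hphase using fun s (hs : s ∈ F) =>
    exists_block_of_mem_phaseSet (hF s hs) hq hM hle 0
  obtain ⟨s, hs, s', hs', hne, heq⟩ := Finset.exists_ne_map_eq_of_card_lt_of_maps_to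
    (s := F) (t := (Finset.univ : Finset A) ×ˢ Finset.range D) (f := fun s => (c s, j s / h))
    (by simpa using hcard) (fun s hs => by
      simpa using Nat.div_lt_of_lt_mul ((hj s hs).trans_eq (mul_comm _ _)))
  have hjne : j s ≠ j s' := by
    intro h1
    apply hne
    have h2 := hphase s hs
    have h3 := hphase s' hs'
    rw [h1] at h2
    linear_combination h2 - h3
  wlog hlt : j s < j s' generalizing s s'
  · exact this s' hs' s hs hne.symm heq.symm hjne.symm (by omega)
  simp only [Prod.mk.injEq] at heq
  obtain ⟨hc, hdiv⟩ := heq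
  have hdiff : j s' - j s < h := by
    have h1 := Nat.div_add_mod (j s) h
    have h2 := Nat.div_add_mod (j s') h
    have h3 := Nat.mod_lt (j s') hh0
    rw [hdiv] at h1
    omega
  refine isPeriodicSystem_of_period (v := substPow σ (m + k₀) (c s)) (ℓ := j s' - j s) (by omega)
    (hk₀ m _ (fun e => (Nat.succ_le_of_lt hdiff).trans (hb e)) (c s)) fun r hr => ?_
  have h1 := hread s hs _ hr
  have h2 := hread s' hs' r (by rw [← hc]; omega)
  rw [← hc] at h2
  simp only [zero_add] at h1 h2
  rw [h1, h2]
  congr 2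
  omega

end Bound

/-! ### The periodic spectrum -/

section Spectrum

theorem mem_periodicSpectrum_of_eigenfunction {Z : Type*} [TopologicalSpace Z] {S : Z ≃ₜ Z} {q : ℕ}
    (hq : 0 < q) (f : Z → ZMod q) (hS : ∀ z, f (S z) = f z + 1)
    (hf : ∀ s, IsClosed (f ⁻¹' {s})) : q ∈ periodicSpectrum S := by
  have : NeZero q := ⟨hq.ne'⟩
  have hcont : Continuous f := continuous_iff_isClosed.2 fun C _ => by
    rw [← Set.biUnion_preimage_singleton]
    exact C.toFinite.isClosed_biUnion fun s _ => hf s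
  have hit : ∀ (i : ℕ) z, f (S^[i] z) = f z + i := by
    intro i z
    induction i with
    | zero => simp
    | succ i ih => rw [Function.iterate_succ_apply', hS, ih]; push_cast; ring
  have himage : ∀ i : ℕ, S^[i] '' (f ⁻¹' {0}) = f ⁻¹' {(i : ZMod q)} := by
    intro i
    ext z
    constructor
    · rintro ⟨y, hy, rfl⟩
      simp_all
    · intro hz
      obtain ⟨y, rfl⟩ := S.surjective.iterate i z
      refine ⟨y, ?_, rfl⟩
      simpa [hit] using hz
  refine ⟨hq, f ⁻¹' {0}, ?_, ?_, ?_⟩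
  · intro i _
    rw [himage]
    exact (isClopen_discrete _).preimage hcont
  · intro i hi j hj hij
    rw [himage, himage]
    refine Disjoint.preimage f (Set.disjoint_singleton.2 fun h => hij ?_)
    rw [ZMod.natCast_eq_natCast_iff'] at h
    rwa [Nat.mod_eq_of_lt hi, Nat.mod_eq_of_lt hj] at h
  · refine Set.eq_univ_of_forall fun z => Set.mem_iUnion₂.2 ⟨(f z).val, ZMod.val_lt _, ?_⟩
    rw [himage]
    simp

/-- In a partition `Y, S Y, …, S^{q-1} Y`, the times between visits to `Y` are multiples of `q`, and
every orbit visits `Y` within `q` steps. -/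
theorem return_times_of_partition {Z : Type*} {S : Z → Z} (hS : Function.Bijective S) {q : ℕ}
    (hq : 0 < q) {Y : Set Z}
    (hdisj : ∀ i < q, ∀ j < q, i ≠ j → Disjoint (S^[i] '' Y) (S^[j] '' Y))
    (hunion : (⋃ i < q, S^[i] '' Y) = Set.univ) :
    (∀ z ∈ Y, ∀ k, S^[k] z ∈ Y → q ∣ k) ∧ ∀ z, ∃ g ≤ q, S^[g] z ∈ Y := by
  have hcover : ∀ z, ∃ i < q, z ∈ S^[i] '' Y := by
    intro z
    have := Set.mem_univ z
    rw [← hunion] at this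
    simpa using this
  have hret : ∀ z ∈ Y, S^[q] z ∈ Y := by
    intro z hz
    obtain ⟨i, hi, y, hy, hyz⟩ := hcover (S^[q] z)
    rcases Nat.eq_zero_or_pos i with rfl | hi0
    · exact hyz ▸ hy
    -- otherwise `S^[q-1] z` would lie in two members of the partition
    exfalso
    have h1 : S^[i - 1] y = S^[q - 1] z := by
      apply hS.1
      rwa [← Function.iterate_succ_apply' S, ← Function.iterate_succ_apply' S,
        Nat.succ_eq_add_one, Nat.succ_eq_add_one, Nat.sub_add_cancel hq, Nat.sub_add_cancel hi0]
    exact Set.disjoint_left.1 (hdisj (i - 1) (by omega) (q - 1) (by omega) (by omega))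
      ⟨y, hy, h1⟩ ⟨z, hz, rfl⟩
  have hret' : ∀ a, ∀ z ∈ Y, S^[q * a] z ∈ Y := by
    intro a
    induction a with
    | zero => intro z hz; simpa using hz
    | succ a ih =>
      intro z hz
      rw [mul_add_one, Function.iterate_add_apply]
      exact ih _ (hret z hz)
  refine ⟨fun z hz k hk => ?_, fun z => ?_⟩
  · by_contra hdvd
    have h1 : 0 < k % q := Nat.pos_of_ne_zero fun h => hdvd (Nat.dvd_of_mod_eq_zero h)
    refine Set.disjoint_left.1 (hdisj (k % q) (Nat.mod_lt _ hq) 0 hq h1.ne') 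
      (show S^[k] z ∈ _ from ⟨S^[q * (k / q)] z, hret' _ z hz, ?_⟩) ⟨_, hk, rfl⟩
    rw [← Function.iterate_add_apply, Nat.mod_add_div]
  · obtain ⟨i, hi, y, hy, rfl⟩ := hcover z
    refine ⟨q - i, Nat.sub_le _ _, ?_⟩
    rw [← Function.iterate_add_apply, Nat.sub_add_cancel hi.le]
    exact hret y hy

variable {A : Type*} {σ : A → List A} [TopologicalSpace A] [DiscreteTopology A]

/-- Membership in a clopen subset of a subshift depends on finitely many coordinates. -/
theorem exists_window_of_isClopen [Finite A] {X : Subshift A ℤ} {Y : Set X.carrier}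
    (hY : IsClopen Y) :
    ∃ N : ℕ, ∀ z z' : X.carrier, (∀ i : ℤ, |i| ≤ N → z.1 i = z'.1 i) → z ∈ Y → z' ∈ Y := by
  have : CompactSpace X.carrier := isCompact_iff_compactSpace.1 X.isClosed.isCompact
  let cyl (N : ℕ) (z : X.carrier) : Set X.carrier := {z' | ∀ i : ℤ, |i| ≤ N → z.1 i = z'.1 i}
  have hcyl_open : ∀ N z, IsOpen (cyl N z) := by
    intro N z
    have : cyl N z = ⋂ i ∈ Set.Icc (-N : ℤ) N, {z' : X.carrier | z'.1 i = z.1 i} := by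
      ext z'
      simp [cyl, abs_le, eq_comm]
    rw [this]
    refine (Set.finite_Icc _ _).isOpen_biInter fun i _ => ?_
    have hi : Continuous fun z' : X.carrier => z'.1 i :=
      (continuous_apply i).comp continuous_subtype_val
    exact (isOpen_discrete {z.1 i}).preimage hi
  have hcyl_basis : ∀ (U : Set X.carrier), IsOpen U → ∀ z ∈ U, ∃ N, cyl N z ⊆ U := by
    intro U hU z hz
    obtain ⟨V, hV, rfl⟩ := isOpen_induced_iff.1 hU
    obtain ⟨I, u, hu, hIu⟩ := isOpen_pi_iff.1 hV z.1 hz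
    obtain ⟨N, hN⟩ := (I.image Int.natAbs).bddAbove
    refine ⟨N, fun z' hz' => hIu fun i hi => ?_⟩
    have : i.natAbs ≤ N := hN (by simpa using ⟨i, hi, rfl⟩)
    rw [← hz' i (by rw [Int.abs_eq_natAbs]; exact_mod_cast this)]
    exact (hu i hi).2
  have hmono : ∀ {M N : ℕ}, M ≤ N → ∀ z, cyl N z ⊆ cyl M z := fun h z z' hz' i hi =>
    hz' i (hi.trans (by exact_mod_cast h))
  let U (N : ℕ) : Set X.carrier := {z | ∀ z' ∈ cyl N z, (z ∈ Y ↔ z' ∈ Y)}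
  have hU_open : ∀ N, IsOpen (U N) := by
    intro N
    refine isOpen_iff_forall_mem_open.2 fun z hz =>
      ⟨cyl N z, fun y hy y' hy' => ?_, hcyl_open N z, fun _ _ => rfl⟩
    exact (hz y hy).symm.trans (hz y' fun i hi => (hy i hi).trans (hy' i hi))
  obtain ⟨N, hN⟩ := isCompact_univ.elim_directed_cover U hU_open (fun z _ => by
    rw [Set.mem_iUnion]
    by_cases hz : z ∈ Y
    · obtain ⟨N, hN⟩ := hcyl_basis Y hY.isOpen z hz
      exact ⟨N, fun z' hz' => iff_of_true hz (hN hz')⟩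
    · obtain ⟨N, hN⟩ := hcyl_basis Yᶜ hY.compl.isOpen z hz
      exact ⟨N, fun z' hz' => iff_of_false hz (hN hz')⟩)
    (directed_of_isDirected_le fun M N h z hz z' hz' => hz z' (hmono h z hz'))
  exact ⟨N, fun z z' h hz => (hN (Set.mem_univ z) z' h).1 hz⟩

/-- If `q` is in the periodic spectrum, then `q` divides the lengths of late iterates: for letters
`c`, `d` in succession, the words `σ^t(c)` and `σ^t(d)` begin with a common long prefix, so
`|σ^t(c)|` is the time between two visits to the clopen set. -/
theorem exists_dvd_length_of_mem_periodicSpectrum [Finite A] (hprim : IsPrimitiveSubst σ)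
    (hprop : IsProperSubst σ) (hne : (substSubshift σ).carrier.Nonempty) {q : ℕ}
    (hq : q ∈ periodicSpectrum (subshiftHomeo (substSubshift σ))) :
    ∃ m, ∀ c, q ∣ (substPow σ m c).length := by
  obtain ⟨hq0, Y, hclopen, hdisj, hunion⟩ := hq
  obtain ⟨hret, hvisit⟩ := return_times_of_partition
    (subshiftHomeo (substSubshift σ)).bijective hq0 hdisj hunion
  obtain ⟨N, hN⟩ := exists_window_of_isClopen (by simpa using hclopen 0 hq0)
  obtain ⟨x, hx⟩ := hne
  obtain ⟨a, ha⟩ := hprop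
  obtain ⟨s, hs⟩ := exists_mem_phaseSet (q := 1) hprim one_pos hx
  obtain ⟨t, ht⟩ := (eventually_le_length_substPow hprim hx (2 * N + 1 + q)).exists
  refine ⟨t + 1, fun c => ?_⟩
  -- the common prefix
  have hpre : ∀ d, ∃ w, substPow σ (t + 1) d = substPow σ t a ++ w := by
    intro d
    obtain ⟨w, hw⟩ := ha d
    refine ⟨substWord (substPow σ t) w, ?_⟩
    have : substPow σ 1 d = a :: w := by simp [substPow, substWord, hw]
    rw [substPow_add, this]
    simp [substWord]
  -- a letter `d` that follows `c`, and an occurrence of `σ^(t+1)(c) σ^(t+1)(d)` in `x`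
  obtain ⟨i₁, -, hi₁, -⟩ := exists_readsAt_of_mem_phaseSet hprim hs (t := 0)
    (fun _ => one_dvd _) 0 c
  have hc : x i₁ = c := by
    have := hi₁ 0 (by simp [substPow])
    simpa [substPow] using this.symm
  have hcd : [c, x (i₁ + 1)] ∈ substLanguage σ := by
    have := hx i₁ 2
    simpa [factorWord, hc, List.ofFn_succ] using this
  set d := x (i₁ + 1)
  obtain ⟨K, hK⟩ := (eventually_isInfix_substPow hprim hcd).exists
  obtain ⟨i₂, hi₂, hread, -⟩ := exists_readsAt_of_mem_phaseSet hprim hs (t := t + 1 + K)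
    (fun _ => one_dvd _) 0 c
  obtain ⟨v₁, v₂, hv⟩ := substWord_isInfix (substPow σ (t + 1)) (hK c)
  rw [← substPow_add] at hv
  rw [← hv] at hread
  have hmid := hread.middle
  have hsplit : substWord (substPow σ (t + 1)) [c, d] =
      substPow σ (t + 1) c ++ substPow σ (t + 1) d := by simp [substWord]
  rw [hsplit] at hmid
  have hta := ht a
  obtain ⟨P, hP⟩ := Int.eq_ofNat_of_zero_le (show 0 ≤ i₂ + v₁.length by omega)
  rw [hP] at hmid
  set ℓ := (substPow σ (t + 1) c).length with hℓ
  have hfirst : ∀ r < (substPow σ t a).length, (substPow σ t a)[r]? = some (x (P + r)) := by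
    intro r hr
    obtain ⟨w, hw⟩ := hpre c
    have := hmid r (by rw [hw]; simp only [List.length_append]; omega)
    rwa [zero_add, hw, List.append_assoc, List.getElem?_append_left hr] at this
  have hsecond : ∀ r < (substPow σ t a).length,
      (substPow σ t a)[r]? = some (x (P + (ℓ + r : ℕ))) := by
    intro r hr
    obtain ⟨w, hw⟩ := hpre d
    have := hmid (ℓ + r) (by rw [hw]; simp only [List.length_append]; omega)
    rwa [zero_add, List.getElem?_append_right (by omega), ← hℓ, Nat.add_sub_cancel_left, hw,
      List.getElem?_append_left hr] at this
  have hsame : ∀ r < (substPow σ t a).length, x (P + r) = x (P + (ℓ + r : ℕ)) := fun r hr =>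
    Option.some.inj ((hfirst r hr).symm.trans (hsecond r hr))
  -- a visit to `Y` whose window lies in the common prefix
  obtain ⟨g, hg, hgY⟩ := hvisit ((subshiftHomeo (substSubshift σ))^[P + N] ⟨x, hx⟩)
  refine hret _ hgY ℓ (hN _ _ (fun i hi => ?_) hgY)
  simp only [iterate_subshiftHomeo_apply]
  rw [abs_le] at hi
  have := hsame (i + N + g).toNat (by omega)
  convert this using 2 <;> push_cast <;> omega

/-- A divisor of `p^N` that is at most `B` divides `p^B`. -/
theorem dvd_pow_of_dvd_pow_of_le {e p N B : ℕ} (h : e ∣ p ^ N) (hB : e ≤ B) (he : e ≠ 0) :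
    e ∣ p ^ B := by
  rcases eq_or_ne p 0 with rfl | hp
  · rw [zero_pow (by omega)]
    exact dvd_zero e
  rw [← Nat.factorization_le_iff_dvd he (pow_ne_zero _ hp)] at h ⊢
  intro r
  have h1 := h r
  rw [Nat.factorization_pow, Finsupp.smul_apply, smul_eq_mul] at h1 ⊢
  rcases Nat.eq_zero_or_pos (p.factorization r) with h0 | h0
  · rw [h0] at h1 ⊢
    omega
  · exact ((Nat.factorization_lt r he).le.trans hB).trans (Nat.le_mul_of_pos_right _ h0)

end Spectrum

/-! ### The equivalence -/

section Equivalence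

variable {A : Type*} {σ : A → List A}

/-- Phases modulo `p^(n + B)` are well defined modulo `p^n`, if `B` bounds the number of phases of
a sequence: the differences of phases of one sequence generate a group of order at most `B`, and
such an order divides `p^B`. -/
theorem castHom_eq_of_mem_phaseSet [Finite A] (hprim : IsPrimitiveSubst σ) {p n B m : ℕ}
    (hq : ∀ c, p ^ (n + B) ∣ (substPow σ m c).length) (hp : p ^ (n + B) ≠ 0)
    (hB : ∀ (x : ℤ → A) (F : Finset (ZMod (p ^ (n + B)))),
      (∀ s ∈ F, x ∈ phaseSet σ (p ^ (n + B)) s) → F.card ≤ B)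
    {x : ℤ → A} {s s' : ZMod (p ^ (n + B))} (hs : x ∈ phaseSet σ _ s) (hs' : x ∈ phaseSet σ _ s') :
    ZMod.castHom (pow_dvd_pow p (Nat.le_add_right n B)) (ZMod (p ^ n)) s =
      ZMod.castHom (pow_dvd_pow p (Nat.le_add_right n B)) (ZMod (p ^ n)) s' := by
  have : NeZero (p ^ (n + B)) := ⟨hp⟩
  obtain ⟨g, rfl⟩ : ∃ g, s' = s + g := ⟨s' - s, by ring⟩
  have hsub := phaseSet_subset_of_mem hprim hq hs hs'
  have hmul : ∀ k : ℕ, x ∈ phaseSet σ (p ^ (n + B)) (s + k • g) := by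
    intro k
    induction k with
    | zero => simpa using hs
    | succ k ih =>
      -- move to phase `s`, use the inclusion, and move back
      set j : ℤ := ((k • g).val : ℤ) with hj
      have hjg : (j : ZMod (p ^ (n + B))) = k • g := by
        rw [hj, Int.cast_natCast, ZMod.natCast_zmod_val]
      have h1 := mem_phaseSet_shift ih (-j)
      rw [Int.cast_neg, hjg, add_neg_cancel_right] at h1
      have h2 := mem_phaseSet_shift (hsub h1) j
      rw [hjg] at h2
      simp only [add_neg_cancel_right] at h2
      rwa [succ_nsmul', ← add_assoc]
  have hord : addOrderOf g ≤ B := by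
    classical
    have h1 := hB x ((Finset.range (addOrderOf g)).image fun k => s + k • g) (by
      simp only [Finset.mem_image]
      rintro _ ⟨k, -, rfl⟩
      exact hmul k)
    rwa [Finset.card_image_of_injOn, Finset.card_range] at h1
    intro a ha b hb hab
    exact nsmul_injOn_Iio_addOrderOf (by simpa using ha) (by simpa using hb) (add_left_cancel hab)
  have hdvd : addOrderOf g ∣ p ^ (n + B) := addOrderOf_dvd_of_nsmul_eq_zero (by
    rw [nsmul_eq_mul, ZMod.natCast_self, zero_mul])
  have hzero := addOrderOf_dvd_iff_nsmul_eq_zero.1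
    (dvd_pow_of_dvd_pow_of_le hdvd hord (ne_zero_of_dvd_ne_zero hp hdvd))
  rw [← ZMod.natCast_zmod_val g, nsmul_eq_mul, ← Nat.cast_mul, ZMod.natCast_eq_zero_iff] at hzero
  have hpB : p ^ B ≠ 0 := right_ne_zero_of_mul (pow_add p n B ▸ hp)
  have hgn : p ^ n ∣ g.val := by
    refine Nat.dvd_of_mul_dvd_mul_right (Nat.pos_of_ne_zero hpB) ?_
    rwa [← pow_add, mul_comm g.val]
  rw [map_add, ← ZMod.natCast_zmod_val g, map_natCast, (ZMod.natCast_eq_zero_iff _ _).2 hgn,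
    add_zero]

/-- If the powers of `p` divide the lengths of late iterates, then they are in the periodic
spectrum: the phase is a continuous eigenfunction. -/
theorem pow_mem_periodicSpectrum [TopologicalSpace A] [DiscreteTopology A] [Finite A]
    (hprim : IsPrimitiveSubst σ)
    (hper : ¬ IsPeriodicSystem (subshiftHomeo (substSubshift σ))) {p : ℕ}
    (hp : ∀ n, ∃ m, ∀ c, p ^ n ∣ (substPow σ m c).length) (n : ℕ) :
    p ^ n ∈ periodicSpectrum (subshiftHomeo (substSubshift σ)) := by
  obtain ⟨B, hB⟩ := exists_card_le_of_mem_phaseSet hprim hper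
  obtain ⟨m, hm⟩ := hp (n + B)
  have hq : p ^ (n + B) ≠ 0 := by
    obtain ⟨x⟩ : Nonempty (substSubshift σ).carrier := by
      by_contra hempty
      exact hper ⟨1, one_pos, fun z => absurd ⟨z⟩ hempty⟩
    obtain ⟨k, hk⟩ := exists_mem_substPow hprim
    intro h0
    have h1 := dvd_length_substPow_of_le hm (Nat.le_add_right m k) (x.1 0)
    rw [h0, zero_dvd_iff] at h1
    exact (List.length_pos_of_mem (hk (m + k) (by omega) (x.1 0) (x.1 0))).ne' h1
  have : NeZero (p ^ (n + B)) := ⟨hq⟩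
  choose φ hφ using fun z : (substSubshift σ).carrier =>
    exists_mem_phaseSet hprim (Nat.pos_of_ne_zero hq) z.2
  set C := ZMod.castHom (pow_dvd_pow p (Nat.le_add_right n B)) (ZMod (p ^ n))
  have hC : ∀ z s, z.1 ∈ phaseSet σ _ s → C (φ z) = C s := fun z s hs =>
    castHom_eq_of_mem_phaseSet hprim hm hq (hB _ m hm) (hφ z) hs
  refine mem_periodicSpectrum_of_eigenfunction (Nat.pos_of_ne_zero fun h => hq ?_)
    (fun z => C (φ z)) (fun z => ?_) (fun r => ?_)
  · rw [pow_add, h, zero_mul]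
  · have h1 := mem_phaseSet_shift (hφ z) 1
    rw [hC _ (φ z + 1), map_add, map_one]
    have h2 : (subshiftHomeo (substSubshift σ) z).1 = fun i => z.1 (i + 1) :=
      funext (iterate_subshiftHomeo_apply _ 1 z)
    rw [h2]
    simpa using h1
  · have : (fun z => C (φ z)) ⁻¹' {r} =
        ⋃ s ∈ {s | C s = r}, Subtype.val ⁻¹' phaseSet σ (p ^ (n + B)) s := by
      ext z
      simp only [Set.mem_preimage, Set.mem_singleton_iff, Set.mem_iUnion, exists_prop]
      exact ⟨fun h => ⟨φ z, h, hφ z⟩, fun ⟨s, h, hs⟩ => (hC z s hs).trans h⟩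
    rw [this]
    exact (Set.toFinite _).isClosed_biUnion fun s _ =>
      (isClosed_phaseSet _ s).preimage continuous_subtype_val

end Equivalence

theorem mainTheorem5 {A : Type*} [Fintype A] [TopologicalSpace A] [DiscreteTopology A]
    (σ : A → List A) (hprim : IsPrimitiveSubst σ) (hprop : IsProperSubst σ)
    (hper : ¬ IsPeriodicSystem (subshiftHomeo (substSubshift σ))) (p : ℕ) :
    (∀ n : ℕ, ∃ m : ℕ, p ^ n ∣ Finset.univ.gcd fun c : A => (substPow σ m c).length) ↔
      ∀ n : ℕ, p ^ n ∈ periodicSpectrum (subshiftHomeo (substSubshift σ)) := by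
  simp only [Finset.dvd_gcd_iff, Finset.mem_univ, true_imp_iff]
  refine ⟨fun h => pow_mem_periodicSpectrum hprim hper h, fun h n =>
    exists_dvd_length_of_mem_periodicSpectrum hprim hprop ?_ (h n)⟩
  by_contra hempty
  exact hper ⟨1, one_pos, fun z => absurd ⟨z.1, z.2⟩ hempty⟩
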